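/- Let $q$ be a prime power, $\alpha\in\mathbb F_q^*$ an element of order $r$, and $q-1=rk$. A linear code $C\subseteq\mathbb F_q^n$ is $\alpha$-constacyclic if, under $(c_0,\dots,c_{n-1})\mapsto c_0+c_1x+\dots+c_{n-1}x^{n-1}$, it is an ideal of $\mathbb F_q[x]/(x^n-\alpha)$; $C^\perp$ is the Euclidean dual, and $\mathrm{wt}(S)$ is the least Hamming weight of a nonzero vector of $S$. In $\mathbb C^{q^n}$, with orthonormal basis $|x\rangle$, $x\in\mathbb F_q^n$, let $X(a)|x\rangle=|x+a\rangle$ and $Z(b)|x\rangle=w^{\mathrm{tr}(b\cdot x)}|x\rangle$, where $w=e^{2\pi \mathrm i/p}$, $p=\operatorname{char}\mathbb F_q$, and $\mathrm{tr}$ is the trace $\mathbb F_q\to\mathbb F_p$. A subspace $Q$ detects an operator $E$ if for some scalar $c$ one has $\langle u,Ev\rangle=c\langle u,v\rangle$ for all $u,v\in Q$, where $c=0$ is required when $\dim Q=1$. An asymmetric quantum code $[[n,K]]_q$ with distances $d_x$ (qudit-flip) and $d_z$ (phase-shift) is a $q^K$-dimensional subspace $Q$ such that: - a single recovery operation corrects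 all errors $X(a)Z(b)$ with $\mathrm{wt}(a)\le\lfloor (d_x-1)/2\rfloor$ and $\mathrm{wt}(b)\le\lfloor (d_z-1)/2\rfloor$; - $Q$ detects all $X(a)Z(b)$ with $(a,b)\ne(0,0)$, $\mathrm{wt}(a)<d_x$ and $\mathrm{wt}(b)<d_z$; - $Q$ fails to detect some $X(a)$ with $a\neq 0$ of weight $d_x$ and some $Z(b)$ with $b\neq 0$ of weight $d_z$. For linear codes with $C_2^\perp\subseteq C_1$, the CSS code of $(C_1,C_2)$ is the span of the states $\sum_{y\in C_1^\perp}|x+y\rangle$, $x\in C_2$. It is a pure asymmetric quantum MDS code with parameters $K,d_x,d_z$ if it is an asymmetric quantum code with these parameters, $d_x=\mathrm{wt}(C_2)$ and $d_z=\mathrm{wt}(C_1)$, moreover $d_x=\mathrm{wt}(C_2\setminus C_1^\perp)$ and $d_z=\mathrm{wt}(C_1\setminus C_2^\perp)$ when $K>0$, and $K=n-d_x-d_z+2$ (equality in the asymmetric quantum Singleton bound). Say that *$[[n,K,d/d']]_q$ is attained* if there are linear codes $C_1,C_2\subseteq\mathbb F_q^n$ with $C_2^\perp\subseteq C_1$,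 both $C_1$ and $C_2^\perp$ being $\alpha$-constacyclic, such that the CSS code of $(C_1,C_2)$ is a pure asymmetric quantum MDS code with parameters $K$, $d_x=d$, $d_z=d'$, and the CSS code of $(C_2,C_1)$ is one with parameters $K$, $d_x=d'$, $d_z=d$. **Theorem.** 1. If $q$ is odd, $n=q+1$, $r\ge2$ and $k$ is odd, then $[[n,\,2(j-i),\,(n-2j-1)/(2i+3)]]_q$ is attained for all integers $0\le i\le j\le \frac n2-2$. 2. If $q\equiv1\pmod 4$, $n=\frac{q+1}2$, $r\ge2$ and $k$ is even, then $[[n,\,2(j-i),\,(n-2j)/(2i+2)]]_q$ is attained for all integers $0\le i\le j\le\frac{n-1}2-1$. 3. If $q=2^t$ with $t\ge3$ and $n=q+1$, then $[[n,\,2(j-i),\,(n-2j-1)/(2i+3)]]_q$ is attained for all integers $0\le i\le j\le\frac{n-1}2-2$. -/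

import Mathlib

open scoped Matrix

/-! ### Classical linear codes of length `n` over a finite field `F` -/

/-- The Euclidean dual code `C^⊥`. -/
def dualCode {F : Type*} [Field F] {n : ℕ} (C : Submodule F (Fin n → F)) :
    Submodule F (Fin n → F) where
  carrier := {x | ∀ c ∈ C, c ⬝ᵥ x = 0}
  zero_mem' := fun c _ => dotProduct_zero c
  add_mem' := fun {x y} hx hy c hc => by
    rw [dotProduct_add, hx c hc, hy c hc, add_zero]
  smul_mem' := fun s x hx c hc => by
    rw [dotProduct_smul, hx c hc, smul_zero]

/-- `d` is the minimum Hamming weight `wt(S)` of the nonzero vectors of `S`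
(in particular such vectors exist). -/
def HasMinWeight {F : Type*} [Field F] [DecidableEq F] {n : ℕ}
    (S : Set (Fin n → F)) (d : ℕ) : Prop :=
  IsLeast {w : ℕ | ∃ c ∈ S, c ≠ 0 ∧ hammingNorm c = w} d

/-- `C` is an `α`-constacyclic code: under the correspondence
`(c₀, …, cₙ₋₁) ↦ c₀ + c₁ x + ⋯ + cₙ₋₁ xⁿ⁻¹` it is an ideal of `F[x] / (xⁿ - α)`. -/
def IsConstacyclic {F : Type*} [Field F] {n : ℕ} (α : F)
    (C : Submodule F (Fin n → F)) : Prop :=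
  ∃ I : Ideal (AdjoinRoot (Polynomial.X ^ n - Polynomial.C α : Polynomial F)),
    ∀ c : Fin n → F, c ∈ C ↔
      AdjoinRoot.mk (Polynomial.X ^ n - Polynomial.C α : Polynomial F)
        (∑ i : Fin n, Polynomial.C (c i) * Polynomial.X ^ (i : ℕ)) ∈ I

/-! ### Quantum codes

The Hilbert space is `ℂ^(q^n)`, written as `(Fin n → F) → ℂ`, with orthonormal basis
`|x⟩ = Pi.single x 1` labelled by the vectors `x` over `F`; the inner product of `u` and `v` is
`star u ⬝ᵥ v`, and operators are matrices. -/

/-- Qudit-flip error: `X(a) |x⟩ = |x + a⟩`. -/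
def errorX {F : Type*} [Field F] [DecidableEq F] {n : ℕ} (a : Fin n → F) :
    Matrix (Fin n → F) (Fin n → F) ℂ :=
  Matrix.of fun y x => if y = x + a then 1 else 0

/-- Phase-shift error: `Z(b) |x⟩ = w ^ tr(b₁ x₁ + ⋯ + bₙ xₙ) |x⟩`, where `w = exp(2πi/p)` and `tr` is
the trace from `F` to its prime field. (`ZMod.stdAddChar j = exp(2πi j/p)`.) -/
noncomputable def errorZ (p : ℕ) [Fact p.Prime] {F : Type*} [Field F] [DecidableEq F]
    [Algebra (ZMod p) F] {n : ℕ} (b : Fin n → F) : Matrix (Fin n → F) (Fin n → F) ℂ :=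
  Matrix.diagonal fun x => ZMod.stdAddChar (N := p) (Algebra.trace (ZMod p) F (b ⬝ᵥ x))

/-- `Q` corrects every error of the set `S`: there is one recovery operation (a trace-preserving
completely positive map, given by Kraus operators `R₀, …, Rₘ₋₁`) that restores every state of `Q`,
up to a scalar, after any error of `S`. -/
def Corrects {V : Type*} [Fintype V] [DecidableEq V] (Q : Submodule ℂ (V → ℂ))
    (S : Set (Matrix V V ℂ)) : Prop :=
  ∃ (m : ℕ) (R : Fin m → Matrix V V ℂ), ∑ l, (R l)ᴴ * R l = 1 ∧
    ∀ E ∈ S, ∀ l, ∃ c : ℂ, ∀ v ∈ Q, (R l * E) *ᵥ v = c • v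

/-- `Q` detects the error `E`: there is a scalar `c` with `⟨u, E v⟩ = c ⟨u, v⟩` on `Q`. For
one-dimensional `Q` this would hold for every `E`, and, as usual, `c = 0` is required then. -/
def Detects {V : Type*} [Fintype V] (Q : Submodule ℂ (V → ℂ)) (E : Matrix V V ℂ) : Prop :=
  ∃ c : ℂ, (Module.finrank ℂ Q = 1 → c = 0) ∧
    ∀ u ∈ Q, ∀ v ∈ Q, star u ⬝ᵥ (E *ᵥ v) = c * (star u ⬝ᵥ v)

/-- `Q` is an asymmetric quantum code of length `n` over `F`, `q = |F|`, of dimension `q ^ k`, whose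
distance for qudit-flip errors is `dx` and whose distance for phase-shift errors is `dz`. -/
structure IsAsymmetricQuantumCode (p : ℕ) [Fact p.Prime] {F : Type*} [Field F] [Fintype F]
    [DecidableEq F] [Algebra (ZMod p) F] {n : ℕ} (Q : Submodule ℂ ((Fin n → F) → ℂ))
    (k dx dz : ℕ) : Prop where
  dim : Module.finrank ℂ Q = Fintype.card F ^ k
  corrects : Corrects Q {E | ∃ a b : Fin n → F, hammingNorm a ≤ (dx - 1) / 2 ∧
    hammingNorm b ≤ (dz - 1) / 2 ∧ E = errorX a * errorZ p b}
  detects : ∀ a b : Fin n → F, (a, b) ≠ 0 → hammingNorm a < dx → hammingNorm b < dz →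
    Detects Q (errorX a * errorZ p b)
  sharp_x : ∃ a : Fin n → F, a ≠ 0 ∧ hammingNorm a = dx ∧ ¬ Detects Q (errorX a)
  sharp_z : ∃ b : Fin n → F, b ≠ 0 ∧ hammingNorm b = dz ∧ ¬ Detects Q (errorZ p b)

/-- The (unnormalized) state `∑_{y ∈ D} |x + y⟩`. -/
noncomputable def cosetState {F : Type*} [Field F] {n : ℕ} (D : Submodule F (Fin n → F))
    (x : Fin n → F) : (Fin n → F) → ℂ :=
  Set.indicator {y | y - x ∈ D} 1

/-- The CSS code of `C₁` and `C₂` (where `C₂^⊥ ⊆ C₁`, equivalently `C₁^⊥ ⊆ C₂`): the span of the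
states `∑_{y ∈ C₁^⊥} |x + y⟩` with `x ∈ C₂`. With this choice `wt(C₂ ∖ C₁^⊥)` belongs to the
qudit-flip errors and `wt(C₁ ∖ C₂^⊥)` to the phase-shift errors. -/
noncomputable def cssCode {F : Type*} [Field F] {n : ℕ} (C₁ C₂ : Submodule F (Fin n → F)) :
    Submodule ℂ ((Fin n → F) → ℂ) :=
  Submodule.span ℂ (cosetState (dualCode C₁) '' (C₂ : Set (Fin n → F)))

/-- The CSS code of `C₁` and `C₂` is a pure asymmetric quantum code with parameters
`n`, `k`, `dx`, `dz`, and it is MDS: it attains the asymmetric quantum Singleton bound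
`k ≤ n - dx - dz + 2` with equality. Purity says `dx = wt(C₂)` and `dz = wt(C₁)`;
if `k = 0`, then `C₂ ∖ C₁^⊥` and `C₁ ∖ C₂^⊥` are empty and have no weight. -/
structure IsPureCSSMDS (p : ℕ) [Fact p.Prime] {F : Type*} [Field F] [Fintype F]
    [DecidableEq F] [Algebra (ZMod p) F] {n : ℕ} (C₁ C₂ : Submodule F (Fin n → F))
    (k dx dz : ℕ) : Prop where
  dual_le : dualCode C₂ ≤ C₁
  code : IsAsymmetricQuantumCode p (cssCode C₁ C₂) k dx dz
  weight_x : 0 < k → HasMinWeight ((C₂ : Set (Fin n → F)) \ (dualCode C₁ : Set (Fin n → F))) dx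
  weight_z : 0 < k → HasMinWeight ((C₁ : Set (Fin n → F)) \ (dualCode C₂ : Set (Fin n → F))) dz
  pure_x : HasMinWeight (C₂ : Set (Fin n → F)) dx
  pure_z : HasMinWeight (C₁ : Set (Fin n → F)) dz
  singleton_eq : k + dx + dz = n + 2

/-- There are asymmetric quantum MDS codes `[[n, k, d/d']]` constructed from `α`-constacyclic codes:
`C₂^⊥ ⊆ C₁` are `α`-constacyclic, the CSS code of `(C₁, C₂)` has `dx = d`, `dz = d'`, and the
CSS code of `(C₂, C₁)`, in which the two roles are exchanged, has `dx = d'`, `dz = d`. -/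
def ExistsConstacyclicAQMDS (p : ℕ) [Fact p.Prime] {F : Type*} [Field F] [Fintype F]
    [DecidableEq F] [Algebra (ZMod p) F] (α : F) (n k d d' : ℕ) : Prop :=
  ∃ C₁ C₂ : Submodule F (Fin n → F),
    IsConstacyclic α C₁ ∧ IsConstacyclic α (dualCode C₂) ∧
    IsPureCSSMDS p C₁ C₂ k d d' ∧ IsPureCSSMDS p C₂ C₁ k d' d

/-! ### Linear codes: duality, the Singleton bound, MDS codes. -/

section LinearCodes

variable {F : Type*} [Field F] {n : ℕ}

/-! Let `K` be the quadratic extension of `F`, `θ ∈ K` a primitive `n`-th root of unity with `θ ^ (q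
+ 1) = 1`, and `δ ∈ K` with `δ ^ n = α`. The roots of `x ^ n - α` are the `δ θ ^ l`. If `δ ^ q = δ θ
^ s` with `s ∈ {0, 1}`, Frobenius acts on the exponents by `l ↦ s - l`, so the interval `-m, …, m +
s` is stable. Let `Z m` be the constacyclic code with these `N = 2 m + 1 + s` zeros. Stability makes
the zeros cost at most `N` conditions over `F`, the BCH bound gives weight above `N`, and the
Singleton bound then forces dimension `n - N`: the code is MDS (`isMDSCode_zeroCode`).

Take `C₁ = Z i` and `C₂ = (Z j)^⊥` for `i ≤ j`. Then `C₂^⊥ = Z j ⊆ Z i = C₁`, duals of MDS codes are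
MDS, and the weights and dimensions give the stated parameters. That MDS pairs yield pure asymmetric
quantum MDS codes is `isPureCSSMDS_of_isMDSCode`: an error `X(a)Z(b)` with `a ∉ C₂` or `b ∉ C₁` maps
the CSS code to an orthogonal subspace, which gives detection and, through differences of errors,
correction.

Only `δ` depends on the case. In case 1, `k` odd makes `α` a nonsquare, which yields `δ` with `s =
1`. In case 2, `α ^ n = α`, so `δ = α` and `s = 0`. In case 3, `α = η ^ 2`, so `δ = η θ ^ (q / 2)`
and `s = 1`. -/

theorem dualCode_eq_orthogonal (C : Submodule F (Fin n → F)) :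
    dualCode C = LinearMap.BilinForm.orthogonal (dotProductBilin F F) C := by
  ext x
  simp only [LinearMap.BilinForm.mem_orthogonal_iff]
  rfl

theorem dotProductBilin_nondegenerate :
    LinearMap.BilinForm.Nondegenerate
      (dotProductBilin F F : (Fin n → F) →ₗ[F] (Fin n → F) →ₗ[F] F) :=
  ⟨fun x hx => dotProduct_eq_zero x hx,
    fun x hx => dotProduct_eq_zero x fun y => (dotProduct_comm x y).trans (hx y)⟩

theorem dotProductBilin_isRefl :
    LinearMap.BilinForm.IsRefl
      (dotProductBilin F F : (Fin n → F) →ₗ[F] (Fin n → F) →ₗ[F] F) :=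
  fun x y h => (dotProduct_comm y x).trans h

theorem dualCode_dualCode (C : Submodule F (Fin n → F)) : dualCode (dualCode C) = C := by
  rw [dualCode_eq_orthogonal, dualCode_eq_orthogonal]
  exact LinearMap.BilinForm.orthogonal_orthogonal dotProductBilin_nondegenerate
    dotProductBilin_isRefl C

theorem finrank_add_finrank_dualCode (C : Submodule F (Fin n → F)) :
    Module.finrank F C + Module.finrank F (dualCode C) = n := by
  have h := LinearMap.BilinForm.finrank_orthogonal
    (dotProductBilin_nondegenerate (F := F) (n := n)) C
  have h2 := Submodule.finrank_le C
  rw [← dualCode_eq_orthogonal] at h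
  rw [Module.finrank_fin_fun] at h h2
  omega

theorem dualCode_antitone {C D : Submodule F (Fin n → F)} (h : C ≤ D) :
    dualCode D ≤ dualCode C :=
  fun _ hx c hc => hx c (h hc)

theorem dualCode_le_comm {C D : Submodule F (Fin n → F)} (h : dualCode C ≤ D) :
    dualCode D ≤ C := by
  simpa only [dualCode_dualCode] using dualCode_antitone h

variable [DecidableEq F]

theorem hammingNorm_le_of_eq_zero_on {T : Finset (Fin n)} {c : Fin n → F}
    (h : ∀ i ∈ T, c i = 0) : hammingNorm c + T.card ≤ n := by
  have : hammingNorm c ≤ Tᶜ.card := by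
    refine Finset.card_le_card fun i hi => ?_
    rw [Finset.mem_compl]
    intro hT
    exact (Finset.mem_filter.1 hi).2 (h i hT)
  rw [Finset.card_compl, Fintype.card_fin] at this
  have := Finset.card_le_univ T
  rw [Fintype.card_fin] at this
  omega

/-- Every nonzero word of `C` has weight at least `n - dim C + 1`. -/
def IsMDSCode (C : Submodule F (Fin n → F)) : Prop :=
  ∀ c ∈ C, c ≠ 0 → n < Module.finrank F C + hammingNorm c

/-- The coordinates in a set of at most `dim C` elements can be prescribed in an MDS code. -/
theorem IsMDSCode.exists_eq_on {C : Submodule F (Fin n → F)} (hC : IsMDSCode C)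
    {T : Finset (Fin n)} (hT : T.card ≤ Module.finrank F C) (f : Fin n → F) :
    ∃ c ∈ C, ∀ i ∈ T, c i = f i := by
  have hk : Module.finrank F C ≤ n := by simpa using Submodule.finrank_le C
  obtain ⟨S, hTS, -, hS⟩ := Finset.exists_subsuperset_card_eq (Finset.subset_univ T) hT
    (by simpa using hk)
  let g : C →ₗ[F] (S → F) := (LinearMap.funLeft F F (Subtype.val : S → Fin n)).comp C.subtype
  -- A word vanishing on `dim C` coordinates has weight at most `n - dim C`, so it is zero;
  -- injectivity then gives surjectivity by dimension.
  have hg : Function.Injective g := by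
    rw [← LinearMap.ker_eq_bot, LinearMap.ker_eq_bot']
    rintro ⟨c, hc⟩ h
    by_contra h0
    have h1 := hC c hc fun h => h0 (Subtype.ext h)
    have h2 := hammingNorm_le_of_eq_zero_on (T := S) (c := c)
      fun i hi => congrFun h ⟨i, hi⟩
    omega
  have hgs : Function.Surjective g :=
    (LinearMap.injective_iff_surjective_of_finrank_eq_finrank (by simp [hS])).1 hg
  obtain ⟨c, hc⟩ := hgs fun i => f i
  exact ⟨c, c.2, fun i hi => congrFun hc ⟨i, hTS hi⟩⟩

/-- If a nonzero dual word `x` had weight at most `dim C`, some word of `C` would equal a unit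
vector on the support of `x`, and its product with `x` would be a nonzero coordinate of `x`. -/
theorem IsMDSCode.dualCode {C : Submodule F (Fin n → F)} (hC : IsMDSCode C) :
    IsMDSCode (dualCode C) := by
  intro x hx h0
  by_contra hle
  have h1 := finrank_add_finrank_dualCode C
  obtain ⟨i, hi⟩ := Function.ne_iff.1 h0
  obtain ⟨c, hc, hcx⟩ := hC.exists_eq_on (T := Finset.univ.filter fun i => x i ≠ 0)
    (by change hammingNorm x ≤ _; omega) (Pi.single i 1)
  have h2 : c ⬝ᵥ x = x i := by
    rw [dotProduct, Finset.sum_eq_single i]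
    · rw [hcx i (by simpa using hi)]; simp
    · intro j _ hj
      by_cases hxj : x j = 0
      · rw [hxj, mul_zero]
      · rw [hcx j (by simpa using hxj)]; simp [hj]
    · simp
  exact hi (h2 ▸ hx c hc)

/-- The Singleton bound. -/
theorem exists_hammingNorm_add_finrank_le (C : Submodule F (Fin n → F))
    (hC : 0 < Module.finrank F C) :
    ∃ c ∈ C, c ≠ 0 ∧ hammingNorm c + Module.finrank F C ≤ n + 1 := by
  have hk : Module.finrank F C ≤ n := by simpa using Submodule.finrank_le C
  obtain ⟨S, -, hS⟩ := Finset.exists_subset_card_eq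
    (s := (Finset.univ : Finset (Fin n))) (n := Module.finrank F C - 1) (by simp; omega)
  let g : C →ₗ[F] (S → F) := (LinearMap.funLeft F F (Subtype.val : S → Fin n)).comp C.subtype
  have hg : LinearMap.ker g ≠ ⊥ := LinearMap.ker_ne_bot_of_finrank_lt (by simp [hS]; omega)
  obtain ⟨c, hc, h0⟩ := Submodule.exists_mem_ne_zero_of_ne_bot hg
  refine ⟨c, c.2, fun h => h0 (Subtype.ext h), ?_⟩
  have := hammingNorm_le_of_eq_zero_on (T := S) (c := (c : Fin n → F))
      fun i hi => congrFun (LinearMap.mem_ker.1 hc) ⟨i, hi⟩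
  omega

theorem IsMDSCode.hasMinWeight {C : Submodule F (Fin n → F)} (hC : IsMDSCode C)
    (hk : 0 < Module.finrank F C) {d : ℕ} (hd : d + Module.finrank F C = n + 1) :
    HasMinWeight (C : Set (Fin n → F)) d := by
  obtain ⟨c, hc, h0, hw⟩ := exists_hammingNorm_add_finrank_le C hk
  refine ⟨⟨c, hc, h0, ?_⟩, ?_⟩
  · have := hC c hc h0
    omega
  · rintro _ ⟨c, hc, h0, rfl⟩
    have := hC c hc h0
    omega

theorem HasMinWeight.diff {S T : Set (Fin n → F)} {d : ℕ} (hS : HasMinWeight S d)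
    (hT : ∀ c ∈ T, c ≠ 0 → d < hammingNorm c) : HasMinWeight (S \ T) d := by
  obtain ⟨⟨c, hc, h0, hw⟩, hmin⟩ := hS
  refine ⟨⟨c, ⟨hc, fun hcT => (hT c hcT h0).ne' hw⟩, h0, hw⟩, ?_⟩
  rintro _ ⟨c, hc, h0, rfl⟩
  exact hmin ⟨c, hc.1, h0, rfl⟩

end LinearCodes

/-! ### Recovery from errors with orthogonal images. -/

section ErrorCorrection

variable {V : Type*} [Fintype V] [DecidableEq V]

theorem exists_projection_matrix (Q : Submodule ℂ (V → ℂ)) :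
    ∃ P : Matrix V V ℂ, Pᴴ = P ∧ P * P = P ∧ (∀ v ∈ Q, P *ᵥ v = v) ∧ ∀ v, P *ᵥ v ∈ Q := by
  let Q' : Submodule ℂ (EuclideanSpace ℂ V) :=
    Q.comap (WithLp.linearEquiv 2 ℂ (V → ℂ)).toLinearMap
  let e := Matrix.toEuclideanCLM (n := V) (𝕜 := ℂ)
  have he : ∀ v, (e.symm Q'.starProjection) *ᵥ v =
      (Q'.starProjection (WithLp.toLp 2 v)).ofLp := fun v => by
    conv_rhs => rw [← e.apply_symm_apply Q'.starProjection]
    rfl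
  refine ⟨e.symm Q'.starProjection, ?_, ?_, fun v hv => ?_, fun v => ?_⟩
  · have hs := map_star e.symm.toStarAlgHom Q'.starProjection
    rw [(isSelfAdjoint_starProjection Q').star_eq] at hs
    exact hs.symm
  · rw [← map_mul]
    congr 1
    exact Q'.isIdempotentElem_starProjection
  · rw [he, Submodule.starProjection_eq_self_iff.2 (show WithLp.toLp 2 v ∈ Q' from hv)]
  · rw [he]
    exact Submodule.starProjection_apply_mem Q' _

theorem Matrix.eq_zero_of_forall_star_dotProduct {A : Matrix V V ℂ}
    (h : ∀ u v, star u ⬝ᵥ (A *ᵥ v) = 0) : A = 0 := by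
  ext i j
  have := h (Pi.single i 1) (Pi.single j 1)
  simpa [Pi.star_single] using this

/-- A family of isometries mapping `Q` to pairwise orthogonal subspaces can be corrected. -/
theorem corrects_range_of_orthogonal (Q : Submodule ℂ (V → ℂ)) {ι : Type*} [Fintype ι]
    [DecidableEq ι] (E : ι → Matrix V V ℂ) (hE : ∀ i, (E i)ᴴ * E i = 1)
    (h : ∀ i j, i ≠ j → ∀ u ∈ Q, ∀ v ∈ Q, star (E i *ᵥ u) ⬝ᵥ (E j *ᵥ v) = 0) :
    Corrects Q (Set.range E) := by
  obtain ⟨P, hPs, hPP, hPv, hPQ⟩ := exists_projection_matrix Q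
  -- These are the Knill–Laflamme conditions in nondegenerate form.
  have hsand : ∀ i j, P * (E i)ᴴ * (E j * P) = if i = j then P else 0 := by
    intro i j
    split_ifs with hij
    · subst hij
      rw [Matrix.mul_assoc, ← Matrix.mul_assoc _ (E i), hE, Matrix.one_mul, hPP]
    · apply Matrix.eq_zero_of_forall_star_dotProduct
      intro u v
      rw [← h i j hij _ (hPQ u) _ (hPQ v), ← Matrix.mulVec_mulVec, Matrix.dotProduct_mulVec,
        Matrix.mulVec_mulVec, Matrix.mulVec_mulVec, Matrix.star_mulVec,
        Matrix.conjTranspose_mul, hPs]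
  -- `S` is the orthogonal projection onto the sum of the subspaces `E i Q`. The recovery measures
  -- which subspace occurs and undoes `E i`; the extra Kraus operator `1 - S` makes it trace
  -- preserving.
  let S : Matrix V V ℂ := ∑ i, E i * P * (E i)ᴴ
  have hSE : ∀ j, S * (E j * P) = E j * P := by
    intro j
    simp only [S, Matrix.sum_mul]
    rw [Finset.sum_eq_single j]
    · rw [Matrix.mul_assoc (E j) P, Matrix.mul_assoc (E j), hsand, if_pos rfl]
    · intro i _ hij
      rw [Matrix.mul_assoc (E i) P, Matrix.mul_assoc (E i), hsand, if_neg hij, Matrix.mul_zero]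
    · simp
  have hSs : Sᴴ = S := by
    simp only [S, Matrix.conjTranspose_sum, Matrix.conjTranspose_mul,
      Matrix.conjTranspose_conjTranspose, hPs, Matrix.mul_assoc]
  have hSS : S * S = S := by
    have : S * S = ∑ j, S * (E j * P * (E j)ᴴ) := Matrix.mul_sum _ _ _
    rw [this]
    exact Finset.sum_congr rfl fun j _ => by rw [← Matrix.mul_assoc, hSE]
  let R : Option ι → Matrix V V ℂ := fun o => o.elim (1 - S) fun i => P * (E i)ᴴ
  let e := Fintype.equivFin (Option ι)
  refine ⟨_, R ∘ e.symm, ?_, ?_⟩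
  · refine (Equiv.sum_comp e.symm fun o => (R o)ᴴ * R o).trans ?_
    rw [Fintype.sum_option]
    have h1 : ∀ i, (R (some i))ᴴ * R (some i) = E i * P * (E i)ᴴ := fun i => by
      simp only [R, Option.elim, Matrix.conjTranspose_mul, Matrix.conjTranspose_conjTranspose, hPs]
      rw [← Matrix.mul_assoc, Matrix.mul_assoc (E i), hPP]
    have h2 : (R none)ᴴ * R none = 1 - S := by
      simp only [R, Option.elim, Matrix.conjTranspose_sub, Matrix.conjTranspose_one, hSs]
      rw [Matrix.mul_sub, Matrix.sub_mul, Matrix.sub_mul, hSS]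
      simp
    simp only [h1, h2]
    exact sub_add_cancel _ _
  · rintro _ ⟨j, rfl⟩ l
    have key : ∃ c : ℂ, R (e.symm l) * (E j * P) = c • P := by
      rcases e.symm l with _ | i
      · refine ⟨0, ?_⟩
        simp only [R, Option.elim]
        rw [Matrix.sub_mul, hSE, Matrix.one_mul, sub_self, zero_smul]
      · refine ⟨if i = j then 1 else 0, ?_⟩
        simp only [R, Option.elim]
        rw [hsand]
        split_ifs <;> simp
    obtain ⟨c, hc⟩ := key
    refine ⟨c, fun v hv => ?_⟩
    have := congrArg (fun M => M *ᵥ v) hc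
    rw [Matrix.smul_mulVec, hPv v hv] at this
    rw [← this, ← Matrix.mul_assoc, ← Matrix.mulVec_mulVec _ _ P, hPv v hv]
    rfl

end ErrorCorrection

/-! ### Flip and phase errors, and the characters behind them. -/

section Errors

variable (p : ℕ) [Fact p.Prime] {F : Type*} [Field F] [Algebra (ZMod p) F] {n : ℕ}

/-- The phase `w ^ tr(b · x)`. -/
noncomputable def phase (b x : Fin n → F) : ℂ :=
  ZMod.stdAddChar (N := p) (Algebra.trace (ZMod p) F (b ⬝ᵥ x))

theorem phase_add_right (b x y : Fin n → F) : phase p b (x + y) = phase p b x * phase p b y := by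
  simp only [phase, dotProduct_add, map_add, AddChar.map_add_eq_mul]

theorem phase_add_left (b c x : Fin n → F) : phase p (b + c) x = phase p b x * phase p c x := by
  simp only [phase, add_dotProduct, map_add, AddChar.map_add_eq_mul]

theorem phase_zero_left (x : Fin n → F) : phase p 0 x = 1 := by
  simp [phase]

theorem phase_zero_right (b : Fin n → F) : phase p b 0 = 1 := by
  simp [phase]

theorem star_phase (b x : Fin n → F) : star (phase p b x) = phase p (-b) x := by
  simp only [phase, neg_dotProduct, map_neg]
  rw [AddChar.map_neg_eq_conj]
  rfl

/-- Since `D` is closed under scalars, a nonzero `b · d` can be rescaled to any element of `F`, and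
the trace form is nondegenerate. -/
theorem exists_phase_ne_one [Finite F] {D : Submodule F (Fin n → F)} {b : Fin n → F}
    (hb : b ∉ dualCode D) : ∃ d ∈ D, phase p b d ≠ 1 := by
  have : ∃ d ∈ D, b ⬝ᵥ d ≠ 0 := by
    by_contra! h
    exact hb fun d hd => (dotProduct_comm d b).trans (h d hd)
  obtain ⟨d, hd, h0⟩ := this
  have htr := (traceForm_nondegenerate (ZMod p) F).1
  have : ∃ s : F, Algebra.trace (ZMod p) F (b ⬝ᵥ d * s) ≠ 0 := by
    by_contra! h
    exact h0 (htr _ h)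
  obtain ⟨s, hs⟩ := this
  refine ⟨s • d, D.smul_mem s hd, fun h => hs ?_⟩
  rw [phase, dotProduct_smul, smul_eq_mul, mul_comm] at h
  exact ((ZMod.isPrimitive_stdAddChar p).zmod_char_eq_one_iff p _).1 h

theorem phase_eq_one_of_mem_dualCode {D : Submodule F (Fin n → F)} {b d : Fin n → F}
    (hb : b ∈ dualCode D) (hd : d ∈ D) : phase p b d = 1 := by
  rw [phase, dotProduct_comm, hb d hd, map_zero, AddChar.map_zero_eq_one]

variable [Fintype F] [DecidableEq F]

theorem errorX_mulVec (a : Fin n → F) (v : (Fin n → F) → ℂ) (y : Fin n → F) :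
    (errorX a *ᵥ v) y = v (y - a) := by
  simp only [Matrix.mulVec, dotProduct, errorX, Matrix.of_apply, ite_mul, one_mul, zero_mul]
  rw [Finset.sum_eq_single (y - a)]
  · simp
  · intro x _ hx
    rw [if_neg]
    rintro rfl
    exact hx (by simp)
  · simp

theorem errorZ_mulVec (b : Fin n → F) (v : (Fin n → F) → ℂ) (y : Fin n → F) :
    (errorZ p b *ᵥ v) y = phase p b y * v y := by
  rw [errorZ, Matrix.mulVec_diagonal]
  rfl

theorem errorX_mul_errorZ_mulVec (a b : Fin n → F) (v : (Fin n → F) → ℂ) (y : Fin n → F) :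
    ((errorX a * errorZ p b) *ᵥ v) y = phase p b (y - a) * v (y - a) := by
  rw [← Matrix.mulVec_mulVec, errorX_mulVec, errorZ_mulVec]

/-- Up to a phase, the adjoint of one error times another is the error of the differences. This
reduces correction to detection. -/
theorem star_error_mulVec_dotProduct (a b a' b' : Fin n → F) (u v : (Fin n → F) → ℂ) :
    star ((errorX a * errorZ p b) *ᵥ u) ⬝ᵥ ((errorX a' * errorZ p b') *ᵥ v) =
      phase p (-b) (a' - a) *
        (star u ⬝ᵥ ((errorX (a' - a) * errorZ p (b' - b)) *ᵥ v)) := by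
  simp only [dotProduct, Finset.mul_sum, Pi.star_apply, errorX_mul_errorZ_mulVec, star_mul,
    star_phase]
  refine (Equiv.sum_comp (Equiv.addRight a) _).symm.trans (Finset.sum_congr rfl fun y _ => ?_)
  have h1 : y + a - a' = y - (a' - a) := by abel
  have h2 : phase p (-b) y = phase p (-b) (y - (a' - a)) * phase p (-b) (a' - a) := by
    rw [← phase_add_right, sub_add_cancel]
  rw [Equiv.coe_addRight, add_sub_cancel_right, h1, sub_eq_add_neg b' b, phase_add_left, h2]
  ring

theorem conjTranspose_error_mul_error (a b : Fin n → F) :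
    (errorX a * errorZ p b)ᴴ * (errorX a * errorZ p b) = 1 := by
  rw [← sub_eq_zero]
  apply Matrix.eq_zero_of_forall_star_dotProduct
  intro u v
  rw [Matrix.sub_mulVec, dotProduct_sub, ← Matrix.mulVec_mulVec, Matrix.dotProduct_mulVec,
    ← Matrix.star_mulVec, star_error_mulVec_dotProduct, sub_self, sub_self, phase_zero_right,
    one_mul, Matrix.one_mulVec, sub_eq_zero]
  congr 1
  ext y
  rw [errorX_mul_errorZ_mulVec, phase_zero_left, one_mul, sub_zero]

end Errors

/-! ### CSS codes and their asymmetric distances. -/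

section CSS

variable {F : Type*} [Field F] {n : ℕ}

theorem cosetState_apply_of_mem {D : Submodule F (Fin n → F)} {x y : Fin n → F}
    (h : y - x ∈ D) : cosetState D x y = 1 :=
  Set.indicator_of_mem (s := {y | y - x ∈ D}) h 1

theorem cosetState_apply_of_notMem {D : Submodule F (Fin n → F)} {x y : Fin n → F}
    (h : y - x ∉ D) : cosetState D x y = 0 :=
  Set.indicator_of_notMem (s := {y | y - x ∈ D}) h 1

theorem cosetState_mem_cssCode (C₁ : Submodule F (Fin n → F)) {C₂ : Submodule F (Fin n → F)}
    {x : Fin n → F} (hx : x ∈ C₂) : cosetState (dualCode C₁) x ∈ cssCode C₁ C₂ :=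
  Submodule.subset_span ⟨x, hx, rfl⟩

variable [Fintype F] {C₁ C₂ : Submodule F (Fin n → F)}

/-- The CSS code consists of the functions supported on `C₂` and invariant under `C₁^⊥`. -/
theorem mem_cssCode_iff (h : dualCode C₁ ≤ C₂) {f : (Fin n → F) → ℂ} :
    f ∈ cssCode C₁ C₂ ↔ (∀ x ∉ C₂, f x = 0) ∧ ∀ d ∈ dualCode C₁, ∀ x, f (x + d) = f x := by
  classical
  constructor
  · intro hf
    induction hf using Submodule.span_induction with
    | mem f hf =>
      obtain ⟨x, hx, rfl⟩ := hf
      refine ⟨fun y hy => cosetState_apply_of_notMem fun hyx => hy ?_, fun d hd y => ?_⟩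
      · simpa using C₂.add_mem (h hyx) hx
      · have : y + d - x ∈ dualCode C₁ ↔ y - x ∈ dualCode C₁ := by
          rw [add_sub_right_comm]
          exact Submodule.add_mem_iff_left _ hd
        by_cases hy : y - x ∈ dualCode C₁
        · rw [cosetState_apply_of_mem hy, cosetState_apply_of_mem (this.2 hy)]
        · rw [cosetState_apply_of_notMem hy, cosetState_apply_of_notMem (this.not.2 hy)]
    | zero => simp
    | add f g _ _ hf hg =>
      exact ⟨fun x hx => by simp [hf.1 x hx, hg.1 x hx],
        fun d hd x => by simp [hf.2 d hd x, hg.2 d hd x]⟩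
    | smul c f _ hf =>
      exact ⟨fun x hx => by simp [hf.1 x hx], fun d hd x => by simp [hf.2 d hd x]⟩
  · rintro ⟨hf1, hf2⟩
    -- `N` is the order of `C₁^⊥`. By invariance, summing `f x` times the coset state of `x` over
    -- all `x` counts each value of `f` exactly `N` times.
    let N : ℂ := ∑ d : Fin n → F, if d ∈ dualCode C₁ then 1 else 0
    have hN : N ≠ 0 := by
      simp only [N, Finset.sum_boole]
      exact Nat.cast_ne_zero.2 (Finset.card_ne_zero_of_mem (a := 0) (by simp))
    have hsum : N • f = ∑ x : Fin n → F, f x • cosetState (dualCode C₁) x := by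
      ext y
      rw [Finset.sum_apply, Pi.smul_apply, smul_eq_mul, Finset.sum_mul]
      refine (Equiv.sum_comp (Equiv.subLeft y) _).symm.trans (Finset.sum_congr rfl fun x _ => ?_)
      rw [Equiv.subLeft_apply, Pi.smul_apply, smul_eq_mul]
      by_cases hx : y - x ∈ dualCode C₁
      · rw [if_pos hx, cosetState_apply_of_mem hx, one_mul, mul_one, ← hf2 _ hx x]
        congr 1
        abel
      · rw [if_neg hx, cosetState_apply_of_notMem hx, zero_mul, mul_zero]
    rw [← (cssCode C₁ C₂).smul_mem_iff hN, hsum]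
    refine Submodule.sum_mem _ fun x _ => ?_
    by_cases hx : x ∈ C₂
    · exact Submodule.smul_mem _ _ (Submodule.subset_span ⟨x, hx, rfl⟩)
    · rw [hf1 x hx, zero_smul]
      exact Submodule.zero_mem _

/-- The function on `Fin n → F` given by a function on `C₂ / C₁^⊥`. -/
noncomputable def cosetLift (C₁ C₂ : Submodule F (Fin n → F)) [DecidablePred (· ∈ C₂)] :
    ((C₂ ⧸ (dualCode C₁).submoduleOf C₂) → ℂ) →ₗ[ℂ] ((Fin n → F) → ℂ) where
  toFun g x := if hx : x ∈ C₂ then g (Submodule.Quotient.mk ⟨x, hx⟩) else 0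
  map_add' g g' := by ext x; by_cases hx : x ∈ C₂ <;> simp [hx]
  map_smul' c g := by ext x; by_cases hx : x ∈ C₂ <;> simp [hx]

theorem finrank_cssCode (h : dualCode C₁ ≤ C₂) :
    Module.finrank ℂ (cssCode C₁ C₂) =
      Fintype.card F ^ (Module.finrank F C₂ - Module.finrank F (dualCode C₁)) := by
  classical
  have hinj : Function.Injective (cosetLift C₁ C₂) := by
    intro g g' hg
    ext x
    obtain ⟨x, rfl⟩ := Submodule.Quotient.mk_surjective _ x
    simpa [cosetLift] using congrFun hg x
  have hrange : LinearMap.range (cosetLift C₁ C₂) = cssCode C₁ C₂ := by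
    ext f
    rw [mem_cssCode_iff h]
    constructor
    · rintro ⟨g, rfl⟩
      refine ⟨fun x hx => by simp [cosetLift, hx], fun d hd x => ?_⟩
      have hdx : x + d ∈ C₂ ↔ x ∈ C₂ := Submodule.add_mem_iff_left _ (h hd)
      by_cases hx : x ∈ C₂
      · simp only [cosetLift, LinearMap.coe_mk, AddHom.coe_mk, dif_pos hx, dif_pos (hdx.2 hx)]
        congr 1
        rw [Submodule.Quotient.eq, Submodule.submoduleOf, Submodule.mem_comap]
        simpa using hd
      · simp [cosetLift, hx, hdx]
    · rintro ⟨h1, h2⟩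
      refine ⟨fun x => f (Quotient.out x : C₂), ?_⟩
      ext x
      by_cases hx : x ∈ C₂
      · simp only [cosetLift, LinearMap.coe_mk, AddHom.coe_mk, dif_pos hx]
        have := Submodule.Quotient.mk_out
          (Submodule.Quotient.mk ⟨x, hx⟩ : C₂ ⧸ (dualCode C₁).submoduleOf C₂)
        rw [Submodule.Quotient.eq, Submodule.submoduleOf, Submodule.mem_comap] at this
        rw [← h2 _ this x, map_sub, Submodule.subtype_apply, Submodule.subtype_apply,
          add_sub_cancel]
        rfl
      · simp [cosetLift, hx, h1]
  rw [← hrange, LinearMap.finrank_range_of_inj hinj, Module.finrank_fintype_fun_eq_card,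
    Module.card_eq_pow_finrank (K := F)]
  congr 1
  have := Submodule.finrank_quotient_add_finrank ((dualCode C₁).submoduleOf C₂)
  rw [(Submodule.submoduleOfEquivOfLe h).finrank_eq] at this
  omega

theorem star_cosetState_dotProduct_self_ne_zero (D : Submodule F (Fin n → F)) (x : Fin n → F) :
    star (cosetState D x) ⬝ᵥ cosetState D x ≠ 0 := by
  classical
  intro h
  open scoped ComplexOrder in
  have h1 := congrFun (dotProduct_star_self_eq_zero.1 h) x
  rw [cosetState_apply_of_mem (by simp)] at h1
  exact one_ne_zero h1

theorem star_cosetState_dotProduct_cosetState_eq_zero {D : Submodule F (Fin n → F)}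
    {x y : Fin n → F} (h : x - y ∉ D) : star (cosetState D x) ⬝ᵥ cosetState D y = 0 := by
  classical
  refine Finset.sum_eq_zero fun z _ => ?_
  rw [Pi.star_apply]
  by_cases hx : z - x ∈ D
  · rw [cosetState_apply_of_notMem (x := y), mul_zero]
    intro hy
    exact h (by simpa using D.sub_mem hy hx)
  · rw [cosetState_apply_of_notMem hx, star_zero, zero_mul]

variable (p : ℕ) [Fact p.Prime] [Algebra (ZMod p) F] [DecidableEq F]

/-- If `a ∉ C₂`, the shift moves the support off `C₂`. If `b ∉ C₁`, some `d ∈ C₁^⊥` has phase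
different from 1; translating the sum by `d` multiplies it by that phase, so it vanishes. -/
theorem cssCode_star_dotProduct_error_eq_zero (h : dualCode C₁ ≤ C₂) {a b : Fin n → F}
    (hab : a ∉ C₂ ∨ b ∉ C₁) {u v : (Fin n → F) → ℂ} (hu : u ∈ cssCode C₁ C₂)
    (hv : v ∈ cssCode C₁ C₂) : star u ⬝ᵥ ((errorX a * errorZ p b) *ᵥ v) = 0 := by
  rw [mem_cssCode_iff h] at hu hv
  rcases hab with ha | hb
  · refine Finset.sum_eq_zero fun y _ => ?_
    rw [errorX_mul_errorZ_mulVec, Pi.star_apply]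
    by_cases hy : y ∈ C₂
    · rw [hv.1 (y - a) fun hya => ha ((Submodule.sub_mem_iff_right _ hy).1 hya)]
      simp
    · rw [hu.1 y hy]
      simp
  · rw [← dualCode_dualCode C₁] at hb
    obtain ⟨d, hd, h1⟩ := exists_phase_ne_one p hb
    refine (mul_eq_zero.1 ?_).resolve_left (sub_ne_zero.2 h1)
    rw [sub_mul, one_mul, sub_eq_zero, dotProduct, Finset.mul_sum]
    symm
    refine (Equiv.sum_comp (Equiv.addRight d) _).symm.trans (Finset.sum_congr rfl fun y _ => ?_)
    rw [errorX_mul_errorZ_mulVec, errorX_mul_errorZ_mulVec, Equiv.coe_addRight, Pi.star_apply,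
      Pi.star_apply, hu.2 d hd, add_sub_right_comm, hv.2 d hd, phase_add_right]
    ring

theorem corrects_cssCode (h : dualCode C₁ ≤ C₂) {dx dz : ℕ}
    (hx : ∀ c ∈ C₂, c ≠ 0 → dx ≤ hammingNorm c) (hz : ∀ c ∈ C₁, c ≠ 0 → dz ≤ hammingNorm c)
    (hdx : 0 < dx) (hdz : 0 < dz) :
    Corrects (cssCode C₁ C₂) {E | ∃ a b : Fin n → F, hammingNorm a ≤ (dx - 1) / 2 ∧
      hammingNorm b ≤ (dz - 1) / 2 ∧ E = errorX a * errorZ p b} := by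
  -- Two distinct correctable vectors differ by a nonzero vector of weight at most `d - 1`, which is
  -- too light for `C`.
  have hlow : ∀ {C : Submodule F (Fin n → F)} {d : ℕ}, 0 < d →
      (∀ c ∈ C, c ≠ 0 → d ≤ hammingNorm c) → ∀ {a a' : Fin n → F},
      hammingNorm a ≤ (d - 1) / 2 → hammingNorm a' ≤ (d - 1) / 2 → a ≠ a' → a' - a ∉ C := by
    intro C d hd hC a a' ha ha' hne hmem
    have h1 := hC _ hmem (sub_ne_zero.2 hne.symm)
    rw [sub_eq_neg_add, ← hammingDist_eq_hammingNorm] at h1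
    have h2 := hammingDist_triangle a 0 a'
    rw [hammingDist_zero_right, hammingDist_zero_left] at h2
    omega
  let ι := {e : (Fin n → F) × (Fin n → F) //
    hammingNorm e.1 ≤ (dx - 1) / 2 ∧ hammingNorm e.2 ≤ (dz - 1) / 2}
  convert corrects_range_of_orthogonal (cssCode C₁ C₂)
    (fun e : ι => errorX e.1.1 * errorZ p e.1.2)
    (fun e => conjTranspose_error_mul_error p _ _) ?_ using 1
  · ext E
    constructor
    · rintro ⟨a, b, ha, hb, rfl⟩
      exact ⟨⟨(a, b), ha, hb⟩, rfl⟩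
    · rintro ⟨⟨⟨a, b⟩, ha, hb⟩, rfl⟩
      exact ⟨a, b, ha, hb, rfl⟩
  · rintro ⟨⟨a, b⟩, ha, hb⟩ ⟨⟨a', b'⟩, ha', hb'⟩ hne u hu v hv
    rw [star_error_mulVec_dotProduct, cssCode_star_dotProduct_error_eq_zero p h _ hu hv, mul_zero]
    by_cases haa : a = a'
    · refine Or.inr (hlow hdz hz hb hb' ?_)
      rintro rfl
      exact hne (by subst haa; rfl)
    · exact Or.inl (hlow hdx hx ha ha' haa)

theorem detects_cssCode (h : dualCode C₁ ≤ C₂) {a b : Fin n → F} (hab : a ∉ C₂ ∨ b ∉ C₁) :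
    Detects (cssCode C₁ C₂) (errorX a * errorZ p b) :=
  ⟨0, fun _ => rfl, fun u hu v hv => by
    rw [cssCode_star_dotProduct_error_eq_zero p h hab hu hv, zero_mul]⟩

theorem errorX_mulVec_cosetState (D : Submodule F (Fin n → F)) (a x : Fin n → F) :
    errorX a *ᵥ cosetState D x = cosetState D (x + a) := by
  ext y
  rw [errorX_mulVec]
  have h : y - a - x = y - (x + a) := by abel
  by_cases hy : y - a - x ∈ D
  · rw [cosetState_apply_of_mem hy, cosetState_apply_of_mem (h ▸ hy)]
  · rw [cosetState_apply_of_notMem hy, cosetState_apply_of_notMem (h ▸ hy)]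

theorem errorZ_mulVec_cosetState {b : Fin n → F} (hb : b ∈ C₁) (x : Fin n → F) :
    errorZ p b *ᵥ cosetState (dualCode C₁) x = phase p b x • cosetState (dualCode C₁) x := by
  ext y
  rw [errorZ_mulVec, Pi.smul_apply, smul_eq_mul]
  by_cases hy : y - x ∈ dualCode C₁
  · rw [← sub_add_cancel y x, phase_add_right,
      phase_eq_one_of_mem_dualCode p ((dualCode_dualCode C₁).symm ▸ hb) hy, one_mul]
  · rw [cosetState_apply_of_notMem hy, mul_zero, mul_zero]

/-- `X(a)` takes the coset state of 0 to that of `a`, so their matrix element is nonzero. Detection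
would make it zero, either because `c = 0` or because the two cosets are disjoint. -/
theorem not_detects_errorX {a : Fin n → F} (ha : a ∈ C₂)
    (h : Module.finrank ℂ (cssCode C₁ C₂) = 1 ∨ a ∉ dualCode C₁) :
    ¬ Detects (cssCode C₁ C₂) (errorX a) := by
  rintro ⟨c, hc, hE⟩
  have h1 := hE _ (cosetState_mem_cssCode C₁ ha) _ (cosetState_mem_cssCode C₁ C₂.zero_mem)
  rw [errorX_mulVec_cosetState, zero_add] at h1
  refine star_cosetState_dotProduct_self_ne_zero _ _ (h1.trans ?_)
  rcases h with h | h
  · rw [hc h, zero_mul]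
  · rw [star_cosetState_dotProduct_cosetState_eq_zero (by simpa using h), mul_zero]

/-- Coset states are eigenvectors of `Z(b)`. Detection makes all eigenvalues equal to `c`, and the
state of 0 gives `c = 1`; this contradicts `c = 0`, or the nontriviality of the phase on `C₂`. -/
theorem not_detects_errorZ {b : Fin n → F} (hb : b ∈ C₁)
    (h : Module.finrank ℂ (cssCode C₁ C₂) = 1 ∨ b ∉ dualCode C₂) :
    ¬ Detects (cssCode C₁ C₂) (errorZ p b) := by
  rintro ⟨c, hc, hE⟩
  have key : ∀ x ∈ C₂, phase p b x = c := fun x hx => by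
    have h1 := hE _ (cosetState_mem_cssCode C₁ hx) _ (cosetState_mem_cssCode C₁ hx)
    rw [errorZ_mulVec_cosetState p hb, dotProduct_smul, smul_eq_mul] at h1
    exact mul_right_cancel₀ (star_cosetState_dotProduct_self_ne_zero _ _) h1
  have h0 := key 0 C₂.zero_mem
  rw [phase_zero_right] at h0
  rcases h with h | h
  · exact one_ne_zero (h0.trans (hc h))
  · obtain ⟨x, hx, h1⟩ := exists_phase_ne_one p h
    exact h1 ((key x hx).trans h0.symm)

/-- The CSS code of two MDS codes is a pure asymmetric quantum MDS code. -/
theorem isPureCSSMDS_of_isMDSCode (h : dualCode C₂ ≤ C₁) (h₁ : IsMDSCode C₁) (h₂ : IsMDSCode C₂)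
    (hpos₁ : 0 < Module.finrank F C₁) (hpos₂ : 0 < Module.finrank F C₂) {k dx dz : ℕ}
    (hk : k + n = Module.finrank F C₁ + Module.finrank F C₂)
    (hdx : dx + Module.finrank F C₂ = n + 1) (hdz : dz + Module.finrank F C₁ = n + 1) :
    IsPureCSSMDS p C₁ C₂ k dx dz := by
  have h' := dualCode_le_comm h
  have hd₁ := finrank_add_finrank_dualCode C₁
  have hd₂ := finrank_add_finrank_dualCode C₂
  have hx := h₂.hasMinWeight hpos₂ hdx
  have hz := h₁.hasMinWeight hpos₁ hdz
  -- Nonzero words of the MDS code `C₁^⊥` have weight above `dim C₁ = dx + k - 1`, so for `k > 0`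
  -- removing them does not change the minimum weight.
  have hgtx : 0 < k → ∀ c ∈ dualCode C₁, c ≠ 0 → dx < hammingNorm c := fun hk0 c hc h0 => by
    have := h₁.dualCode c hc h0
    omega
  have hgtz : 0 < k → ∀ c ∈ dualCode C₂, c ≠ 0 → dz < hammingNorm c := fun hk0 c hc h0 => by
    have := h₂.dualCode c hc h0
    omega
  have hdim : Module.finrank ℂ (cssCode C₁ C₂) = Fintype.card F ^ k := by
    rw [finrank_cssCode h']
    congr 1
    omega
  have hone : k = 0 → Module.finrank ℂ (cssCode C₁ C₂) = 1 := by
    rintro rfl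
    rw [hdim, pow_zero]
  refine ⟨h, ⟨hdim, ?_, ?_, ?_, ?_⟩, fun hk0 => hx.diff (hgtx hk0), fun hk0 => hz.diff (hgtz hk0),
    hx, hz, by omega⟩
  · have hk₁ : Module.finrank F C₁ ≤ n := by omega
    exact corrects_cssCode p h' (fun c hc h0 => hx.2 ⟨c, hc, h0, rfl⟩)
      (fun c hc h0 => hz.2 ⟨c, hc, h0, rfl⟩) (by omega) (by omega)
  · intro a b hab ha hb
    refine detects_cssCode p h' ?_
    by_contra! hmem
    refine hab (Prod.ext ?_ ?_) <;> by_contra h0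
    · exact (hx.2 ⟨a, hmem.1, h0, rfl⟩).not_gt ha
    · exact (hz.2 ⟨b, hmem.2, h0, rfl⟩).not_gt hb
  · obtain ⟨a, ha, h0, hw⟩ := hx.1
    refine ⟨a, h0, hw, not_detects_errorX ha ?_⟩
    rcases Nat.eq_zero_or_pos k with hk0 | hk0
    · exact Or.inl (hone hk0)
    · exact Or.inr fun hmem => (hgtx hk0 a hmem h0).ne' hw
  · obtain ⟨b, hb, h0, hw⟩ := hz.1
    refine ⟨b, h0, hw, not_detects_errorZ p hb ?_⟩
    rcases Nat.eq_zero_or_pos k with hk0 | hk0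
    · exact Or.inl (hone hk0)
    · exact Or.inr fun hmem => (hgtz hk0 b hmem h0).ne' hw

end CSS

/-! ### Codes defined by zeros: BCH bound and dimension. -/

section ZeroCode

variable {F K : Type*} [Field F] [Field K] [Algebra F K] {n : ℕ}

/-- The words `c` such that `c₀ + c₁ x + ⋯ + cₙ₋₁ xⁿ⁻¹` vanishes at all the points `β l`. -/
def zeroCode (F : Type*) {K : Type*} [Field F] [Field K] [Algebra F K] (n : ℕ) {ι : Type*}
    (β : ι → K) : Submodule F (Fin n → F) :=
  ⨅ l, LinearMap.ker (Fintype.linearCombination F fun i : Fin n => β l ^ (i : ℕ))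

theorem mem_zeroCode_iff {ι : Type*} {β : ι → K} {c : Fin n → F} :
    c ∈ zeroCode F n β ↔ ∀ l, ∑ i, c i • β l ^ (i : ℕ) = 0 := by
  simp [zeroCode, Submodule.mem_iInf, Fintype.linearCombination_apply]

theorem isConstacyclic_zeroCode {ι : Type*} {β : ι → K} {α : F}
    (hβ : ∀ l, β l ^ n = algebraMap F K α) : IsConstacyclic α (zeroCode F n β) := by
  have h : ∀ l, (Polynomial.X ^ n - Polynomial.C α : Polynomial F).eval₂
      (algebraMap F K) (β l) = 0 := fun l => by simp [hβ]
  refine ⟨⨅ l, RingHom.ker (AdjoinRoot.lift (algebraMap F K) (β l) (h l)), fun c => ?_⟩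
  rw [mem_zeroCode_iff, Ideal.mem_iInf]
  refine forall_congr' fun l => ?_
  rw [RingHom.mem_ker, AdjoinRoot.lift_mk, Polynomial.eval₂_finsetSum]
  simp [Algebra.smul_def]

/-- The BCH bound. -/
theorem lt_hammingNorm_of_mem_zeroCode [DecidableEq F] {γ θ : K} (hγ : γ ≠ 0)
    (hθ : IsPrimitiveRoot θ n) {N : ℕ} {c : Fin n → F}
    (hc : c ∈ zeroCode F n fun l : Fin N => γ * θ ^ (l : ℕ)) (h0 : c ≠ 0) :
    N < hammingNorm c := by
  by_contra! hle
  rw [mem_zeroCode_iff] at hc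
  obtain ⟨i, hi⟩ := Function.ne_iff.1 h0
  let S : Finset (Fin n) := Finset.univ.filter fun i => c i ≠ 0
  have hiS : i ∈ S := by simpa [S] using hi
  -- If the weight is at most `N`, then `P` has degree below `N`, so its coefficients combine the
  -- `N` parity checks. The combination retains only the term at `i`, which is nonzero.
  let P : Polynomial K := ∏ j ∈ S.erase i, (Polynomial.X - Polynomial.C (θ ^ (j : ℕ)))
  have hP : P.natDegree < N := by
    rw [Polynomial.natDegree_finsetProd_X_sub_C_eq_card, Finset.card_erase_of_mem hiS]
    have : 0 < S.card := Finset.card_pos.2 ⟨i, hiS⟩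
    have : S.card ≤ N := hle
    omega
  have hsum : ∑ j, c j • (γ ^ (j : ℕ) * P.eval (θ ^ (j : ℕ))) = 0 := by
    calc ∑ j, c j • (γ ^ (j : ℕ) * P.eval (θ ^ (j : ℕ)))
        = ∑ j, ∑ l ∈ Finset.range N, P.coeff l * c j • (γ * θ ^ l) ^ (j : ℕ) := by
          refine Finset.sum_congr rfl fun j _ => ?_
          rw [Polynomial.eval_eq_sum_range' hP, Finset.mul_sum, Finset.smul_sum]
          refine Finset.sum_congr rfl fun l _ => ?_
          rw [mul_smul_comm, mul_pow, ← pow_mul, ← pow_mul, mul_comm l]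
          congr 1
          ring
      _ = ∑ l ∈ Finset.range N, P.coeff l * ∑ j, c j • (γ * θ ^ l) ^ (j : ℕ) := by
          rw [Finset.sum_comm]
          exact Finset.sum_congr rfl fun l _ => Finset.mul_sum _ _ _ |>.symm
      _ = 0 := Finset.sum_eq_zero fun l hl => by
          rw [hc ⟨l, Finset.mem_range.1 hl⟩, mul_zero]
  rw [Finset.sum_eq_single i] at hsum
  · rcases smul_eq_zero.1 hsum with h | h
    · exact hi h
    · rcases mul_eq_zero.1 h with h | h
      · exact pow_ne_zero _ hγ h
      · rw [Polynomial.eval_prod, Finset.prod_eq_zero_iff] at h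
        obtain ⟨j, hj, h⟩ := h
        rw [Polynomial.eval_sub, Polynomial.eval_X, Polynomial.eval_C, sub_eq_zero] at h
        exact (Finset.mem_erase.1 hj).1 (Fin.ext (hθ.pow_inj i.2 j.2 h)).symm
  · intro j _ hji
    by_cases hj : c j = 0
    · rw [hj, zero_smul]
    · have : P.eval (θ ^ (j : ℕ)) = 0 := by
        rw [Polynomial.eval_prod]
        exact Finset.prod_eq_zero (i := j) (by simp [S, hj, hji]) (by simp)
      rw [this, mul_zero, smul_zero]
  · simp

theorem sum_smul_pow_card_eq_zero [Fintype F] {c : Fin n → F} {β : K}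
    (h : ∑ i, c i • β ^ (i : ℕ) = 0) : ∑ i, c i • (β ^ Fintype.card F) ^ (i : ℕ) = 0 := by
  have := congrArg (FiniteField.frobeniusAlgHom F K) h
  simpa [map_sum, map_smul, FiniteField.coe_frobeniusAlgHom, ← pow_mul, mul_comm] using this

theorem le_finrank_add_of_ker_le {W : Type*} [AddCommGroup W] [Module F W] [FiniteDimensional F W]
    (φ : (Fin n → F) →ₗ[F] W) {C : Submodule F (Fin n → F)} (h : LinearMap.ker φ ≤ C) :
    n ≤ Module.finrank F C + Module.finrank F W := by
  have h1 := LinearMap.finrank_range_add_finrank_ker φ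
  have h2 := Submodule.finrank_le (LinearMap.range φ)
  have h3 := Submodule.finrank_mono h
  rw [Module.finrank_fin_fun] at h1
  omega

/-- If the Frobenius reverses the progression `γ, γθ, …, γθᴺ⁻¹`, then prescribing these zeros
imposes at most `N` linear conditions over `F`. -/
theorem le_finrank_zeroCode_add [Fintype F] [FiniteDimensional F K] (hK : Module.finrank F K = 2)
    {γ θ : K} {N : ℕ}
    (hconj : ∀ l < N, (γ * θ ^ l) ^ Fintype.card F = γ * θ ^ (N - 1 - l))
    (hmid : Odd N → ∃ η : F, algebraMap F K η = γ * θ ^ (N / 2)) :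
    n ≤ Module.finrank F (zeroCode F n fun l : Fin N => γ * θ ^ (l : ℕ)) + N := by
  -- Only the first half of the zeros is imposed, each costing two dimensions over `F`; the mirrored
  -- half follows by Frobenius. For odd `N` the middle zero lies in `F` and costs one.
  let φ : (Fin n → F) →ₗ[F] (Fin (N / 2) → K) := LinearMap.pi fun l =>
    Fintype.linearCombination F fun i : Fin n => (γ * θ ^ (l : ℕ)) ^ (i : ℕ)
  have hφ : ∀ c, φ c = 0 → ∀ l < N, l ≠ N / 2 ∨ Even N →
      ∑ i, c i • (γ * θ ^ l) ^ (i : ℕ) = 0 := by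
    intro c hc l hl hne
    have h : ∀ m < N / 2, ∑ i, c i • (γ * θ ^ m) ^ (i : ℕ) = 0 := fun m hm => by
      simpa [φ, Fintype.linearCombination_apply] using congrFun hc ⟨m, hm⟩
    by_cases hl2 : l < N / 2
    · exact h l hl2
    · have hlt : N - 1 - l < N / 2 := by
        rcases hne with hne | ⟨m, rfl⟩ <;> omega
      have := sum_smul_pow_card_eq_zero (h _ hlt)
      rw [hconj _ (by omega)] at this
      rwa [show N - 1 - (N - 1 - l) = l by omega] at this
  rcases Nat.even_or_odd N with hN | hN
  · have h1 := le_finrank_add_of_ker_le φ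
      (C := zeroCode F n fun l : Fin N => γ * θ ^ (l : ℕ)) fun c hc =>
      mem_zeroCode_iff.2 fun l => hφ c hc l l.2 (Or.inr hN)
    obtain ⟨m, rfl⟩ := hN
    simp only [Module.finrank_pi_fintype, hK, Finset.sum_const, Finset.card_univ,
      Fintype.card_fin, smul_eq_mul] at h1
    omega
  · obtain ⟨η, hη⟩ := hmid hN
    have h1 := le_finrank_add_of_ker_le
      (φ.prod (Fintype.linearCombination F fun i : Fin n => η ^ (i : ℕ)))
      (C := zeroCode F n fun l : Fin N => γ * θ ^ (l : ℕ)) fun c hc => by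
        rw [LinearMap.ker_prod] at hc
        refine mem_zeroCode_iff.2 fun l => ?_
        by_cases hl : (l : ℕ) = N / 2
        · have := congrArg (algebraMap F K) (LinearMap.mem_ker.1 hc.2)
          simpa [Fintype.linearCombination_apply, hl, ← hη, Algebra.smul_def] using this
        · exact hφ c hc.1 l l.2 (Or.inl hl)
    obtain ⟨m, rfl⟩ := hN
    simp only [Module.finrank_prod, Module.finrank_pi_fintype, hK, Finset.sum_const,
      Finset.card_univ, Fintype.card_fin, smul_eq_mul, Module.finrank_self] at h1
    omega

/-- The count of conditions bounds the dimension below; the BCH and Singleton bounds together bound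
it above by the same number. -/
theorem isMDSCode_zeroCode [Fintype F] [DecidableEq F] [FiniteDimensional F K]
    (hK : Module.finrank F K = 2) {γ θ : K} (hγ : γ ≠ 0) (hθ : IsPrimitiveRoot θ n) {N : ℕ}
    (hN : N < n) (hconj : ∀ l < N, (γ * θ ^ l) ^ Fintype.card F = γ * θ ^ (N - 1 - l))
    (hmid : Odd N → ∃ η : F, algebraMap F K η = γ * θ ^ (N / 2)) :
    IsMDSCode (zeroCode F n fun l : Fin N => γ * θ ^ (l : ℕ)) ∧
      Module.finrank F (zeroCode F n fun l : Fin N => γ * θ ^ (l : ℕ)) + N = n := by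
  have hdim := le_finrank_zeroCode_add (n := n) hK hconj hmid
  refine ⟨fun c hc h0 => ?_, ?_⟩
  · have := lt_hammingNorm_of_mem_zeroCode hγ hθ hc h0
    omega
  · obtain ⟨c, hc, h0, hw⟩ := exists_hammingNorm_add_finrank_le
      (zeroCode F n fun l : Fin N => γ * θ ^ (l : ℕ)) (by omega)
    have := lt_hammingNorm_of_mem_zeroCode hγ hθ hc h0
    omega

end ZeroCode

/-! ### The nested pair of codes built from `δ` and `θ`. -/

section Construction

variable {F K : Type*} [Field F] [Field K] [Algebra F K] [Fintype F] [DecidableEq F] {n : ℕ}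

theorem existsConstacyclicAQMDS_of_root (p : ℕ) [Fact p.Prime] [Algebra (ZMod p) F]
    [FiniteDimensional F K] (hK : Module.finrank F K = 2) {α : F} (hα : α ≠ 0) {δ θ : K}
    (hθ : IsPrimitiveRoot θ n) (hθq : θ ^ (Fintype.card F + 1) = 1)
    (hδ : δ ^ n = algebraMap F K α) {s : ℕ} (hs : s ≤ 1)
    (hδq : δ ^ Fintype.card F = δ * θ ^ s) (hδF : s = 0 → ∃ η : F, algebraMap F K η = δ)
    {i j : ℕ} (hij : i ≤ j) (hj : 2 * j + 1 + s < n) :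
    ExistsConstacyclicAQMDS p α n (2 * (j - i)) (n - 2 * j - s) (2 * i + 2 + s) := by
  have hn : n ≠ 0 := by omega
  have hδ0 : δ ≠ 0 := by
    rintro rfl
    rw [zero_pow hn] at hδ
    exact hα ((map_eq_zero _).1 hδ.symm)
  have hθ0 : θ ≠ 0 := hθ.ne_zero hn
  have hθn : θ ^ n = 1 := hθ.pow_eq_one
  have hθinv : θ ^ Fintype.card F = θ⁻¹ := eq_inv_of_mul_eq_one_left (by rw [← pow_succ, hθq])
  -- The progression starts at exponent `-m`; with `2 * m + 1 + s` terms it ends at `m + s`, as the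
  -- symmetry `l ↦ s - l` requires.
  let γ : ℕ → K := fun m => δ * (θ⁻¹) ^ m
  have hγ0 : ∀ m, γ m ≠ 0 := fun m => mul_ne_zero hδ0 (pow_ne_zero _ (inv_ne_zero hθ0))
  have hγδ : ∀ m l, γ m * θ ^ (m + l) = δ * θ ^ l := fun m l => by
    simp only [γ]
    rw [pow_add, inv_pow]
    field_simp
  have hconj : ∀ m, ∀ l < 2 * m + 1 + s,
      (γ m * θ ^ l) ^ Fintype.card F = γ m * θ ^ (2 * m + 1 + s - 1 - l) := by
    intro m l hl
    have h1 : (γ m * θ ^ l) ^ Fintype.card F = δ * θ ^ s * θ ^ m * (θ⁻¹) ^ l := by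
      simp only [γ]
      rw [mul_pow, mul_pow, ← pow_mul, ← pow_mul, mul_comm m, mul_comm l, pow_mul, pow_mul,
        inv_pow θ (Fintype.card F), hθinv, inv_inv, hδq]
    have h2 : γ m * θ ^ (2 * m + 1 + s - 1 - l) * θ ^ l = δ * θ ^ s * θ ^ m := by
      rw [mul_assoc, ← pow_add, show 2 * m + 1 + s - 1 - l + l = m + (s + m) by omega, hγδ,
        pow_add, mul_assoc]
    rw [h1, ← h2, inv_pow, mul_assoc _ (θ ^ l), mul_inv_cancel₀ (pow_ne_zero _ hθ0), mul_one]
  have hmid : ∀ m, Odd (2 * m + 1 + s) →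
      ∃ η : F, algebraMap F K η = γ m * θ ^ ((2 * m + 1 + s) / 2) := by
    intro m hodd
    -- An odd number of zeros occurs only for `s = 0`, and the middle one is `δ` itself.
    have hs0 : s = 0 := by
      obtain ⟨u, hu⟩ := hodd
      omega
    obtain ⟨η, hη⟩ := hδF hs0
    refine ⟨η, ?_⟩
    rw [show (2 * m + 1 + s) / 2 = m + 0 by omega, hγδ, pow_zero, mul_one, hη]
  have hroot : ∀ m l, (γ m * θ ^ l) ^ n = algebraMap F K α := fun m l => by
    simp only [γ]
    rw [mul_pow, mul_pow, ← pow_mul, ← pow_mul, mul_comm m, mul_comm l, pow_mul, pow_mul,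
      inv_pow θ n, hθn, hδ]
    simp
  let Z : ℕ → Submodule F (Fin n → F) := fun m =>
    zeroCode F n fun l : Fin (2 * m + 1 + s) => γ m * θ ^ (l : ℕ)
  have hZ : ∀ m, 2 * m + 1 + s < n → IsMDSCode (Z m) ∧
      Module.finrank F (Z m) + (2 * m + 1 + s) = n := fun m hm =>
    isMDSCode_zeroCode hK (hγ0 m) hθ hm (hconj m) (hmid m)
  have hZc : ∀ m, IsConstacyclic α (Z m) := fun m => isConstacyclic_zeroCode fun l => hroot m l
  have hle : Z j ≤ Z i := by
    intro c hc
    simp only [Z] at hc ⊢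
    rw [mem_zeroCode_iff] at hc ⊢
    intro l
    -- The interval of exponents for `i` sits inside that for `j`, displaced by `j - i` from its
    -- start.
    have h1 : γ i * θ ^ (l : ℕ) = γ j * θ ^ (l + (j - i) : ℕ) := by
      apply mul_right_cancel₀ (pow_ne_zero i hθ0)
      rw [mul_assoc (γ i), mul_assoc (γ j), ← pow_add, ← pow_add, add_comm (l : ℕ) i, hγδ,
        show (l : ℕ) + (j - i) + i = j + l by omega, hγδ]
    rw [h1]
    exact hc ⟨l + (j - i), by omega⟩
  obtain ⟨hi1, hi2⟩ := hZ i (by omega)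
  obtain ⟨hj1, hj2⟩ := hZ j hj
  have hdual := finrank_add_finrank_dualCode (Z j)
  have hdd : dualCode (dualCode (Z j)) ≤ Z i := by rwa [dualCode_dualCode]
  refine ⟨Z i, dualCode (Z j), hZc i, by rw [dualCode_dualCode]; exact hZc j, ?_, ?_⟩
  · exact isPureCSSMDS_of_isMDSCode p hdd hi1 hj1.dualCode (by omega) (by omega) (by omega)
      (by omega) (by omega)
  · exact isPureCSSMDS_of_isMDSCode p (dualCode_le_comm hdd) hj1.dualCode hi1 (by omega)
      (by omega) (by omega) (by omega) (by omega)

end Construction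

/-! ### Choice of the roots in the quadratic extension, and the three cases. -/

section Roots

variable {F K : Type*} [Field F] [Field K] [Algebra F K] [Fintype F]

/-- A nonsquare `α` of `F` is the norm of some `δ` such that `δ ^ (q - 1)` is a primitive
`(q + 1)`-th root of unity. -/
theorem exists_pow_card_eq_mul_primitiveRoot {g : K}
    (hg : IsPrimitiveRoot g ((Fintype.card F - 1) * (Fintype.card F + 1)))
    (hgen : ∀ x : K, x ≠ 0 → ∃ m : ℕ, g ^ m = x) (hodd : Odd (Fintype.card F)) {α : F}
    (hα : α ≠ 0) (hsq : α ^ ((Fintype.card F - 1) / 2) ≠ 1) :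
    ∃ δ : K, δ ^ (Fintype.card F + 1) = algebraMap F K α ∧
      δ ^ Fintype.card F = δ * g ^ (Fintype.card F - 1) := by
  have hαq := FiniteField.pow_card_sub_one_eq_one α hα
  have hcard : 1 < Fintype.card F := Fintype.one_lt_card
  generalize Fintype.card F = q at *
  obtain ⟨e, he⟩ := hgen (algebraMap F K α) (by simpa using hα)
  obtain ⟨w, hw⟩ : ∃ w, q - 1 = w + w := by
    obtain ⟨w, rfl⟩ := hodd
    exact ⟨w, by omega⟩
  -- Elements of `F` are killed by the exponent `q - 1`, so `e` is a multiple `(q + 1) * m`; `m` is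
  -- odd because `α` is a nonsquare.
  have hdvd : (q - 1) * (q + 1) ∣ (q - 1) * e := by
    apply hg.dvd_of_pow_eq_one
    rw [mul_comm, pow_mul, he, ← map_pow, hαq, map_one]
  obtain ⟨m, rfl⟩ := Nat.dvd_of_mul_dvd_mul_left (by omega) hdvd
  have hg1 := hg.pow_eq_one
  have hm : Odd m := by
    rw [← Nat.not_even_iff_odd]
    rintro ⟨u, rfl⟩
    apply hsq
    apply (algebraMap F K).injective
    rw [map_pow, ← he, map_one, hw, ← pow_mul,
      show (q + 1) * (u + u) * ((w + w) / 2) = (q - 1) * (q + 1) * u by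
        rw [hw, show (w + w) / 2 = w by omega]; ring, pow_mul, hg1, one_pow]
  obtain ⟨u, rfl⟩ := hm
  obtain ⟨v, rfl⟩ : ∃ v, q = v + 1 := ⟨q - 1, by omega⟩
  rw [Nat.add_sub_cancel] at hg1 ⊢
  -- With `q = v + 1` and `m = 2 * u + 1`, the natural candidate `g ^ m` also has norm `α`.
  -- Multiplying it by `g ^ ((q - 1) * u)`, of norm 1, makes its `(q - 1)`-th power exactly `g ^ (q
  -- - 1)`.
  refine ⟨g ^ (1 + (v + 2) * u), ?_, ?_⟩
  · rw [← pow_mul, ← he, show (1 + (v + 2) * u) * (v + 1 + 1) =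
      (v + 1 + 1) * (2 * u + 1) + v * (v + 1 + 1) * u by ring, pow_add, pow_mul _ _ u, hg1,
      one_pow, mul_one]
  · rw [← pow_mul, ← pow_add, show (1 + (v + 2) * u) * (v + 1) =
      1 + (v + 2) * u + v + v * (v + 1 + 1) * u by ring, pow_add _ _ (v * (v + 1 + 1) * u),
      pow_mul _ _ u, hg1, one_pow, mul_one]

end Roots

theorem exists_quadratic_extension (p : ℕ) [Fact p.Prime] (F : Type*) [Field F] [Fintype F]
    [Algebra (ZMod p) F] :
    ∃ (K : Type) (_ : Field K) (_ : Algebra F K) (g : K), FiniteDimensional F K ∧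
      Module.finrank F K = 2 ∧
      IsPrimitiveRoot g ((Fintype.card F - 1) * (Fintype.card F + 1)) ∧
      ∀ x : K, x ≠ 0 → ∃ m : ℕ, g ^ m = x := by
  have : CharP F p := charP_of_injective_algebraMap (algebraMap (ZMod p) F).injective p
  let K := FiniteField.Extension F p 2
  obtain ⟨g, hg⟩ := IsCyclic.exists_generator (α := Kˣ)
  refine ⟨K, inferInstance, inferInstance, g, inferInstance, FiniteField.finrank_extension F p 2,
    ?_, fun x hx => ?_⟩
  · rw [IsPrimitiveRoot.coe_units_iff]
    convert IsPrimitiveRoot.orderOf g using 1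
    rw [orderOf_eq_card_of_forall_mem_zpowers hg, Nat.card_units, FiniteField.natCard_extension,
      Nat.card_eq_fintype_card, mul_comm, ← Nat.sq_sub_sq, one_pow]
  · obtain ⟨m, hm⟩ : Units.mk0 x hx ∈ Submonoid.powers g := by
      rw [mem_powers_iff_mem_zpowers]
      exact hg _
    exact ⟨m, by simpa using congrArg Units.val hm⟩

theorem mainTheorem12 (p : ℕ) [Fact p.Prime] {F : Type*} [Field F] [Fintype F] [DecidableEq F]
    [Algebra (ZMod p) F] (q r k : ℕ) (hq : Fintype.card F = q) (α : Fˣ) (hα : orderOf α = r)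
    (hrk : q - 1 = r * k) :
    (∀ n : ℕ, Odd q → n = q + 1 → 2 ≤ r → Odd k →
      ∀ i j : ℕ, i ≤ j → j + 2 ≤ n / 2 →
        ExistsConstacyclicAQMDS p (α : F) n (2 * (j - i)) (n - 2 * j - 1) (2 * i + 3)) ∧
    (∀ n : ℕ, q % 4 = 1 → n = (q + 1) / 2 → 2 ≤ r → Even k →
      ∀ i j : ℕ, i ≤ j → j + 1 ≤ (n - 1) / 2 →
        ExistsConstacyclicAQMDS p (α : F) n (2 * (j - i)) (n - 2 * j) (2 * i + 2)) ∧
    (∀ n t : ℕ, q = 2 ^ t → 3 ≤ t → n = q + 1 →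
      ∀ i j : ℕ, i ≤ j → j + 2 ≤ (n - 1) / 2 →
        ExistsConstacyclicAQMDS p (α : F) n (2 * (j - i)) (n - 2 * j - 1) (2 * i + 3)) := by
  obtain ⟨K, _, _, g, _, hK, hg, hgen⟩ := exists_quadratic_extension p F
  have hα0 : (α : F) ≠ 0 := α.ne_zero
  have hq1 : 1 < q := hq ▸ Fintype.one_lt_card
  have hr : 0 < r := by
    rw [← hα]
    exact orderOf_pos α
  have hαpow : ∀ m, (α : F) ^ m = 1 ↔ r ∣ m := fun m => by
    rw [← hα, orderOf_dvd_iff_pow_eq_one, ← Units.val_pow_eq_pow_val, Units.val_eq_one]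
  have hpos : 0 < (Fintype.card F - 1) * (Fintype.card F + 1) :=
    Nat.mul_pos (by omega) (by omega)
  have hθ : IsPrimitiveRoot (g ^ (q - 1)) (q + 1) := hg.pow hpos (by rw [hq])
  refine ⟨?_, ?_, ?_⟩
  · rintro n hodd rfl - hk i j hij hj
    -- If `α ^ ((q - 1) / 2) = 1`, then `r` divides `(q - 1) / 2`, so `k = (q - 1) / r` would be
    -- even.
    obtain ⟨δ, hδ, hδq⟩ := exists_pow_card_eq_mul_primitiveRoot hg hgen (hq ▸ hodd) hα0 (by
      rw [Ne, hαpow, hq]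
      rintro ⟨u, hu⟩
      obtain ⟨w, rfl⟩ := hodd
      obtain ⟨v, rfl⟩ := hk
      have h1 : r * (2 * v + 1) = r * (2 * u) := by
        rw [← hrk, mul_left_comm, ← hu]
        omega
      have := Nat.eq_of_mul_eq_mul_left hr h1
      omega)
    exact existsConstacyclicAQMDS_of_root p hK hα0 hθ (by rw [hq]; exact hθ.pow_eq_one)
      (hq ▸ hδ) le_rfl (by rw [hδq, hq, pow_one]) (by simp) hij (by omega)
  · rintro n hq4 rfl - ⟨u, rfl⟩ i j hij hj
    have hθ2 : IsPrimitiveRoot ((g ^ (q - 1)) ^ 2) ((q + 1) / 2) :=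
      hθ.pow (by omega) (by omega)
    -- For even `k`, `r` divides `(q - 1) / 2 = n - 1`, whence `α ^ n = α`.
    refine existsConstacyclicAQMDS_of_root p hK hα0 hθ2 (s := 0) (δ := algebraMap F K α) ?_ ?_
      (by omega) ?_ (fun _ => ⟨_, rfl⟩) hij (by omega)
    · rw [hq, ← pow_mul, mul_comm, pow_mul, hθ.pow_eq_one, one_pow]
    · have h1 : (α : F) ^ ((q - 1) / 2) = 1 := by
        rw [hαpow, hrk]
        exact ⟨u, by rw [← two_mul, mul_left_comm]; omega⟩
      rw [← map_pow, show (q + 1) / 2 = (q - 1) / 2 + 1 by omega, pow_succ, h1, one_mul]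
    · rw [← map_pow, FiniteField.pow_card, pow_zero, mul_one]
  · rintro n t ht h3 rfl i j hij hj
    obtain ⟨u, hu⟩ : ∃ u, q = u + u := by
      obtain ⟨t, rfl⟩ : ∃ t', t = t' + 1 := ⟨t - 1, by omega⟩
      exact ⟨2 ^ t, by rw [ht, pow_succ, mul_two]⟩
    have hchar : ringChar F = 2 := FiniteField.even_card_iff_char_two.2 (by omega)
    obtain ⟨η, hη⟩ := FiniteField.isSquare_of_char_two hchar (α : F)
    have hθ1 := hθ.pow_eq_one
    have hη1 : η ^ q = η := hq ▸ FiniteField.pow_card η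
    generalize g ^ (q - 1) = θ at hθ hθ1
    have hθ0 : θ ≠ 0 := hθ.ne_zero (by omega)
    -- Frobenius fixes `η` and inverts `θ`, so `δ ^ q = δ * θ` amounts to `θ ^ (2 * u + 1) = 1`;
    -- this forces `u = q / 2`. The norm of `δ` is `η ^ 2 = α`.
    refine existsConstacyclicAQMDS_of_root p hK hα0 hθ (s := 1) (δ := algebraMap F K η * θ ^ u)
      (hq ▸ hθ1) ?_ le_rfl ?_ (by simp) hij (by omega)
    · rw [mul_pow, ← pow_mul, mul_comm u, pow_mul, hθ1, one_pow, mul_one, ← map_pow, pow_succ,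
        hη1, hη]
    · rw [hq, mul_pow, ← map_pow, hη1, mul_assoc, pow_one, ← pow_succ]
      congr 1
      apply mul_right_cancel₀ (pow_ne_zero u hθ0)
      rw [← pow_mul, ← pow_add, ← pow_add, show u * q + u = (q + 1) * u by ring, pow_mul, hθ1,
        one_pow, show u + 1 + u = q + 1 by omega, hθ1]
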